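/- Let $\mathbb N=\{1,2,3,\dots\}$. For a real sequence $b(n)$, $n\in\mathbb N$, and $a(n)=-1$ for all $n\ge 0$, consider the Jacobi difference expression $$(\tau f)(n)=a(n)f(n+1)+a(n-1)f(n-1)+b(n)f(n)=-f(n+1)-f(n-1)+b(n)f(n),\qquad n\in\mathbb N.$$ A node of a real sequence $u=(u(n))_{n\ge 0}$ is a point $n\in\mathbb N$ with $u(n)=0$ or $a(n)u(n)u(n+1)>0$. The expression $\tau$ is called oscillatory if one (equivalently, every) not identically vanishing real solution $u=(u(n))_{n\ge0}$ of $(\tau u)(n)=0$, $n\in\mathbb N$, has infinitely many nodes, and nonoscillatory otherwise, that is, if every such solution has only finitely many nodes. Let $\ln_0(x)=x$ and $\ln_{k}(x)=\ln_{k-1}(\ln x)$ for $k\ge1$ denote the iterated logarithms (defined for $x$ sufficiently large, depending on $k$), and for $k\in\{0,1,2,\dots\}$ put, for all sufficiently large $n$, $$b_k(n)=2-\frac14\sum_{j=0}^{k-1}\frac{1}{\prod_{\ell=0}^{j}\ln_\ell(n)^2}.$$ **Corollary 2.2.** Let $k\in\{0,1,2,\dots\}$. Then $\tau$ is nonoscillatory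 if $$\liminf_{n\to\infty}\Big(\prod_{j=0}^{k}\ln_j(n)\Big)^2\big(b(n)-b_k(n)\big)>-\frac14,$$ and oscillatory if $$\limsup_{n\to\infty}\Big(\prod_{j=0}^{k}\ln_j(n)\Big)^2\big(b(n)-b_k(n)\big)<-\frac14.$$ Here the lower and upper limits are taken in $[-\infty,\infty]$. For $k=0$ this is the discrete Kneser criterion, which compares $n^2(b(n)-2)$ with $-\frac14$. -/

import Mathlib

open Filter

/-- The Jacobi difference expression
`(τ f)(n) = a(n) f(n+1) + a(n-1) f(n-1) + b(n) f(n)`, used at the indices `n ≥ 1` only. -/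
def jacobiExpr (a b f : ℕ → ℝ) (n : ℕ) : ℝ :=
  a n * f (n + 1) + a (n - 1) * f (n - 1) + b n * f n

/-- `u` is a nontrivial real-valued solution of `τ u = 0`: the sequence lives on `{0, 1, 2, …}`
and the equation holds at every `n ≥ 1`. -/
def IsNontrivialSolution (a b u : ℕ → ℝ) : Prop :=
  u ≠ 0 ∧ ∀ n : ℕ, 1 ≤ n → jacobiExpr a b u n = 0

/-- The nodes of `u`: the points `n ≥ 1` with `u(n) = 0` or `a(n) u(n) u(n+1) > 0`. -/
def nodes (a u : ℕ → ℝ) : Set ℕ :=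
  {n | 1 ≤ n ∧ (u n = 0 ∨ a n * u n * u (n + 1) > 0)}

/-- `τ` is oscillatory: the nontrivial real solutions of `τ u = 0` have infinitely many nodes.
By Sturm separation it is the same to ask this of one solution or of all of them; the stronger
wording is used, and likewise in `IsNonoscillatory`. -/
def IsOscillatory (a b : ℕ → ℝ) : Prop :=
  ∀ u : ℕ → ℝ, IsNontrivialSolution a b u → (nodes a u).Infinite

/-- `τ` is nonoscillatory: the nontrivial real solutions of `τ u = 0` have finitely many nodes. -/
def IsNonoscillatory (a b : ℕ → ℝ) : Prop :=
  ∀ u : ℕ → ℝ, IsNontrivialSolution a b u → (nodes a u).Finite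

/-- The iterated logarithm `ln_0(x) = x`, `ln_{k+1}(x) = ln_k(ln x)`. For each `k` the values at
large `x` are the genuine ones; only these enter the limits below. -/
noncomputable def iterLog : ℕ → ℝ → ℝ
  | 0, x => x
  | k + 1, x => iterLog k (Real.log x)

/-- `b_k(n) = 2 - (1/4) ∑_{j=0}^{k-1} 1 / ∏_{ℓ=0}^{j} ln_ℓ(n)²`. -/
noncomputable def criticalPotential (k n : ℕ) : ℝ :=
  2 - 1 / 4 * ∑ j ∈ Finset.range k, 1 / ∏ l ∈ Finset.range (j + 1), iterLog l (n : ℝ) ^ 2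

/-- `(∏_{j=0}^{k} ln_j(n))² (b(n) - b_k(n))`. -/
noncomputable def scaledDeviation (k : ℕ) (b : ℕ → ℝ) (n : ℕ) : ℝ :=
  (∏ j ∈ Finset.range (k + 1), iterLog j (n : ℝ)) ^ 2 * (b n - criticalPotential k n)

/-!
Write `z_j = 1 / (ln_0 ⋯ ln_j)` and `S = ∑_{j≤k} z_j`. The function `V = S / 2` is the logarithmic
derivative of `√(ln_0 ⋯ ln_k)` and solves the critical Riccati equation `V' + V² = -(1/4) ∑_{j≤k} z_j²`.
Sampled at the integers, `V` solves the corresponding difference equation up to an error of order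
`S³ = O(n⁻³)` (`le_riccati_iterLogDerivSum`, `riccati_iterLogDerivSum_le`), and this error is
negligible against `z_k²` (`eventually_iterLogDerivSum_pow_le`), the scale on which the hypotheses
compare `b` with the critical potential.

If `b` exceeds the critical value by a multiple of `z_k²`, then `1 + V(n)` is a positive supersolution
of the Riccati difference equation `r(n+1) + 1 / r(n) = b(n+1)` of the solution ratios
`r(n) = u(n+1) / u(n)`. A solution that passes through zero stays above it, so it has no later node
(`isNonoscillatory_of_riccati_le`).

If `b` is below the critical value by a multiple of `z_k²`, suppose that a solution `u` has a positive
tail. It is concave, so `s(n) = u(n+1) / u(n) - 1` lies between `0` and `2 / n`. Writing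
`s = V + z_k y`, the relation `z_k' = -2 V z_k` removes the terms linear in `y`, and what remains is a
discrete form of `y' ≤ -z_k (y² + δ)` (`quotient_decrement`). As `z_k` is the derivative of
`ln_{k+1}`, which is unbounded, `y` would blow up (`false_of_riccati_decrement`), whereas
`z_k y = s - V` is bounded below.
-/

/-! ### Iterated logarithms and their derivatives -/

/-- `1 / (ln_0 x ⋯ ln_{j-1} x)`, which is the derivative of `ln_j` wherever
`ln_0 x, …, ln_{j-1} x ≥ 1`. -/
noncomputable def iterLogDeriv (j : ℕ) (x : ℝ) : ℝ :=
  ∏ l ∈ Finset.range j, (iterLog l x)⁻¹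

/-- `∑_{i<j} 1 / (ln_0 x ⋯ ln_i x)`: minus the logarithmic derivative of `iterLogDeriv j`, and twice
the logarithmic derivative of `√(ln_0 ⋯ ln_{j-1})`. -/
noncomputable def iterLogDerivSum (j : ℕ) (x : ℝ) : ℝ :=
  ∑ i ∈ Finset.range j, iterLogDeriv (i + 1) x

/-- Unfolds the outermost logarithm; the definition unfolds the innermost one. -/
lemma iterLog_succ' (k : ℕ) (x : ℝ) : iterLog (k + 1) x = Real.log (iterLog k x) := by
  induction k generalizing x with
  | zero => rfl
  | succ k ih => exact ih (Real.log x)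

lemma tendsto_iterLog_atTop (k : ℕ) : Tendsto (iterLog k) atTop atTop := by
  induction k with
  | zero => exact tendsto_id
  | succ k ih => exact ih.comp Real.tendsto_log_atTop

lemma eventually_one_le_iterLog (k : ℕ) :
    ∀ᶠ x : ℝ in atTop, ∀ j < k, 1 ≤ iterLog j x := by
  have h := (Finset.eventually_all (Finset.range k) (l := atTop)
    (p := fun j x => 1 ≤ iterLog j x)).2
      fun j _ => (tendsto_iterLog_atTop j).eventually_ge_atTop 1
  filter_upwards [h] with x hx j hj using hx j (Finset.mem_range.2 hj)

lemma iterLog_le_iterLog {k : ℕ} {x y : ℝ} (h : ∀ j < k, 1 ≤ iterLog j x) (hxy : x ≤ y) :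
    ∀ j ≤ k, iterLog j x ≤ iterLog j y := by
  intro j
  induction j with
  | zero => exact fun _ => hxy
  | succ j ih =>
    intro hj
    rw [iterLog_succ', iterLog_succ']
    exact Real.log_le_log (by linarith [h j hj]) (ih (Nat.le_of_succ_le hj))

lemma one_le_iterLog_of_le {k : ℕ} {x y : ℝ} (h : ∀ j < k, 1 ≤ iterLog j x) (hxy : x ≤ y) :
    ∀ j < k, 1 ≤ iterLog j y :=
  fun j hj => (h j hj).trans (iterLog_le_iterLog h hxy j hj.le)

lemma iterLogDeriv_succ (j : ℕ) (x : ℝ) :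
    iterLogDeriv (j + 1) x = iterLogDeriv j x * (iterLog j x)⁻¹ :=
  Finset.prod_range_succ _ _

lemma iterLogDerivSum_succ (j : ℕ) (x : ℝ) :
    iterLogDerivSum (j + 1) x = iterLogDerivSum j x + iterLogDeriv (j + 1) x :=
  Finset.sum_range_succ _ _

lemma iterLogDeriv_pos {k : ℕ} {x : ℝ} (h : ∀ j < k, 1 ≤ iterLog j x) {j : ℕ} (hj : j ≤ k) :
    0 < iterLogDeriv j x :=
  Finset.prod_pos fun l hl =>
    inv_pos.2 (zero_lt_one.trans_le (h l ((Finset.mem_range.1 hl).trans_le hj)))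

lemma iterLogDeriv_le_of_le {k : ℕ} {x y : ℝ} (h : ∀ j < k, 1 ≤ iterLog j x) (hxy : x ≤ y)
    {j : ℕ} (hj : j ≤ k) : iterLogDeriv j y ≤ iterLogDeriv j x := by
  have hy := one_le_iterLog_of_le h hxy
  refine Finset.prod_le_prod (fun l hl => ?_) fun l hl => ?_ <;>
    have hl' : l < k := (Finset.mem_range.1 hl).trans_le hj
  · exact inv_nonneg.2 (zero_le_one.trans (hy l hl'))
  · exact inv_anti₀ (zero_lt_one.trans_le (h l hl')) (iterLog_le_iterLog h hxy l hl'.le)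

lemma iterLogDerivSum_nonneg {k : ℕ} {x : ℝ} (h : ∀ j < k, 1 ≤ iterLog j x) {j : ℕ}
    (hj : j ≤ k) : 0 ≤ iterLogDerivSum j x :=
  Finset.sum_nonneg fun _ hi =>
    (iterLogDeriv_pos h ((Finset.mem_range.1 hi : _ < j).trans_le hj)).le

lemma iterLogDerivSum_mono {k : ℕ} {x : ℝ} (h : ∀ j < k, 1 ≤ iterLog j x) {i j : ℕ}
    (hij : i ≤ j) (hj : j ≤ k) : iterLogDerivSum i x ≤ iterLogDerivSum j x :=
  Finset.sum_le_sum_of_subset_of_nonneg (Finset.range_mono hij) fun _ hl _ =>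
    (iterLogDeriv_pos h ((Finset.mem_range.1 hl : _ < j).trans_le hj)).le

lemma iterLogDerivSum_le_of_le {k : ℕ} {x y : ℝ} (h : ∀ j < k, 1 ≤ iterLog j x) (hxy : x ≤ y)
    {j : ℕ} (hj : j ≤ k) : iterLogDerivSum j y ≤ iterLogDerivSum j x :=
  Finset.sum_le_sum fun _ hi =>
    iterLogDeriv_le_of_le h hxy ((Finset.mem_range.1 hi : _ < j).trans_le hj)

lemma hasDerivAt_iterLog {k : ℕ} {x : ℝ} (h : ∀ j < k, 1 ≤ iterLog j x) :
    ∀ j ≤ k, HasDerivAt (iterLog j) (iterLogDeriv j x) x := by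
  intro j
  induction j with
  | zero =>
    intro _
    have h0 : iterLog 0 = id := rfl
    simpa [h0, iterLogDeriv] using hasDerivAt_id x
  | succ j ih =>
    intro hj
    have := (ih (Nat.le_of_succ_le hj)).log (by linarith [h j hj] : iterLog j x ≠ 0)
    rw [iterLogDeriv_succ, ← div_eq_mul_inv]
    exact this.congr_of_eventuallyEq (Eventually.of_forall fun y => iterLog_succ' j y)

lemma hasDerivAt_iterLogDeriv {k : ℕ} {x : ℝ} (h : ∀ j < k, 1 ≤ iterLog j x) :
    ∀ j ≤ k, HasDerivAt (iterLogDeriv j) (-(iterLogDeriv j x * iterLogDerivSum j x)) x := by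
  intro j
  induction j with
  | zero =>
    intro _
    have h0 : iterLogDeriv 0 = fun _ => 1 := by funext y; simp [iterLogDeriv]
    simpa [h0, iterLogDerivSum] using hasDerivAt_const x (1 : ℝ)
  | succ j ih =>
    intro hj
    have hpos : iterLog j x ≠ 0 := by linarith [h j hj]
    have h1 := (ih (Nat.le_of_succ_le hj)).mul
      ((hasDerivAt_iterLog h j (Nat.le_of_succ_le hj)).inv hpos)
    have h2 : iterLogDeriv (j + 1) = iterLogDeriv j * (iterLog j)⁻¹ := by
      funext y; exact iterLogDeriv_succ j y
    rw [h2]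
    refine h1.congr_deriv ?_
    rw [iterLogDerivSum_succ, iterLogDeriv_succ]
    simp only [Pi.mul_apply, Pi.inv_apply]
    field_simp
    ring

/-- Since `ln_k` tends to infinity, this makes the series `∑ₙ iterLogDeriv k n` diverge. -/
lemma iterLog_add_one_sub_le {k : ℕ} {x : ℝ} (h : ∀ j < k, 1 ≤ iterLog j x) :
    iterLog k (x + 1) - iterLog k x ≤ iterLogDeriv k x := by
  have hd : ∀ y, x ≤ y → HasDerivAt (iterLog k) (iterLogDeriv k y) y := fun y hy =>
    hasDerivAt_iterLog (one_le_iterLog_of_le h hy) k le_rfl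
  obtain ⟨c, hc, hc'⟩ := exists_hasDerivAt_eq_slope (iterLog k) (iterLogDeriv k)
    (lt_add_one x) (fun y hy => (hd y hy.1).continuousAt.continuousWithinAt)
    (fun y hy => hd y hy.1.le)
  have := iterLogDeriv_le_of_le h hc.1.le le_rfl
  rw [add_sub_cancel_left, div_one] at hc'
  linarith

lemma exists_iterLogDeriv_add_one_sub {k : ℕ} {x : ℝ} (h : ∀ j < k, 1 ≤ iterLog j x) {j : ℕ}
    (hj : j ≤ k) : ∃ c, x < c ∧ c < x + 1 ∧
      iterLogDeriv j (x + 1) - iterLogDeriv j x = -(iterLogDeriv j c * iterLogDerivSum j c) := by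
  have hd : ∀ y, x ≤ y → HasDerivAt (iterLogDeriv j)
      (-(iterLogDeriv j y * iterLogDerivSum j y)) y := fun y hy =>
    hasDerivAt_iterLogDeriv (one_le_iterLog_of_le h hy) j hj
  obtain ⟨c, hc, hc'⟩ := exists_hasDerivAt_eq_slope (iterLogDeriv j)
    (fun y => -(iterLogDeriv j y * iterLogDerivSum j y))
    (lt_add_one x) (fun y hy => (hd y hy.1).continuousAt.continuousWithinAt)
    (fun y hy => hd y hy.1.le)
  rw [add_sub_cancel_left, div_one] at hc'
  exact ⟨c, hc.1, hc.2, hc'.symm⟩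

lemma le_iterLogDeriv_add_one {k : ℕ} {x : ℝ} (h : ∀ j < k, 1 ≤ iterLog j x) {j : ℕ}
    (hj : j ≤ k) :
    iterLogDeriv j x * (1 - iterLogDerivSum j x) ≤ iterLogDeriv j (x + 1) := by
  obtain ⟨c, hxc, -, hc⟩ := exists_iterLogDeriv_add_one_sub h hj
  have h1 := mul_le_mul (iterLogDeriv_le_of_le h hxc.le hj) (iterLogDerivSum_le_of_le h hxc.le hj)
    (iterLogDerivSum_nonneg (one_le_iterLog_of_le h hxc.le) hj) (iterLogDeriv_pos h hj).le
  linarith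

/-- Euler step for `D' = -D S` with a quadratic remainder. No second derivative is needed: by the
mean value theorem and monotonicity `D(x+1) - D(x) ≤ -D(x+1) S(x+1)`, and the right-hand side is at
most `-D S (1 - S)²` by the lower bound `le_iterLogDeriv_add_one` for each factor. -/
lemma iterLogDeriv_add_one_le {k : ℕ} {x : ℝ} (h : ∀ j < k, 1 ≤ iterLog j x) {j : ℕ}
    (hj : j ≤ k) (hS : iterLogDerivSum j x ≤ 1) :
    iterLogDeriv j (x + 1) ≤
      iterLogDeriv j x * (1 - iterLogDerivSum j x + 2 * iterLogDerivSum j x ^ 2) := by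
  obtain ⟨c, hxc, hcx, hc⟩ := exists_iterLogDeriv_add_one_sub h hj
  have hc1 := one_le_iterLog_of_le h hxc.le
  have hx1 : x ≤ x + 1 := by linarith
  have hsum : iterLogDerivSum j x * (1 - iterLogDerivSum j x) ≤ iterLogDerivSum j (x + 1) := by
    rw [iterLogDerivSum, Finset.sum_mul]
    refine Finset.sum_le_sum fun i hi => ?_
    have hij : i + 1 ≤ j := Finset.mem_range.1 hi
    refine le_trans ?_ (le_iterLogDeriv_add_one h (hij.trans hj))
    exact mul_le_mul_of_nonneg_left
      (sub_le_sub_left (iterLogDerivSum_mono h hij hj) 1) (iterLogDeriv_pos h (hij.trans hj)).le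
  have h1 := mul_le_mul (iterLogDeriv_le_of_le hc1 hcx.le hj)
    (iterLogDerivSum_le_of_le hc1 hcx.le hj)
    (iterLogDerivSum_nonneg (one_le_iterLog_of_le h hx1) hj) (iterLogDeriv_pos hc1 hj).le
  have hD := (iterLogDeriv_pos h hj).le
  have hS0 := iterLogDerivSum_nonneg h hj
  have h2 := mul_le_mul (le_iterLogDeriv_add_one h hj) hsum
    (mul_nonneg hS0 (sub_nonneg.2 hS)) (iterLogDeriv_pos (one_le_iterLog_of_le h hx1) hj).le
  have h3 : 0 ≤ iterLogDeriv j x * iterLogDerivSum j x ^ 3 := by positivity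
  nlinarith

lemma iterLogDeriv_succ_le_inv {k : ℕ} {x : ℝ} (h : ∀ j < k, 1 ≤ iterLog j x) :
    ∀ j < k, iterLogDeriv (j + 1) x ≤ x⁻¹ := by
  intro j
  induction j with
  | zero => intro _; simp [iterLogDeriv, iterLog]
  | succ j ih =>
    intro hj
    rw [iterLogDeriv_succ]
    exact (mul_le_of_le_one_right (iterLogDeriv_pos h hj.le).le
      (inv_le_one_of_one_le₀ (h _ hj))).trans (ih (Nat.lt_of_succ_lt hj))

lemma iterLogDerivSum_le_div {k : ℕ} {x : ℝ} (h : ∀ j < k, 1 ≤ iterLog j x) :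
    iterLogDerivSum k x ≤ k * x⁻¹ := by
  refine (Finset.sum_le_card_nsmul _ _ x⁻¹ fun i hi =>
    iterLogDeriv_succ_le_inv h i (Finset.mem_range.1 hi)).trans ?_
  simp

lemma inv_le_iterLogDerivSum {k : ℕ} {x : ℝ} (h : ∀ j < k + 1, 1 ≤ iterLog j x) :
    x⁻¹ ≤ iterLogDerivSum (k + 1) x := by
  refine le_trans (le_of_eq ?_) (iterLogDerivSum_mono h (Nat.le_add_left 1 k) le_rfl)
  simp [iterLogDerivSum, iterLogDeriv, iterLog]

lemma iterLog_succ_le_log {k : ℕ} {x : ℝ} (h : ∀ j < k, 1 ≤ iterLog j x) :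
    ∀ j, j + 1 < k → iterLog (j + 1) x ≤ Real.log x := by
  intro j
  induction j with
  | zero => intro _; exact le_rfl
  | succ j ih =>
    intro hj
    rw [iterLog_succ']
    have hj' : j + 1 < k := Nat.lt_of_succ_lt hj
    exact (Real.log_le_self (zero_le_one.trans (h _ hj'))).trans (ih hj')

lemma inv_mul_inv_log_pow_le {k : ℕ} {x : ℝ} (h : ∀ j < k + 1, 1 ≤ iterLog j x) :
    x⁻¹ * (Real.log x)⁻¹ ^ k ≤ iterLogDeriv (k + 1) x := by
  rw [iterLogDeriv, Finset.prod_range_succ', mul_comm]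
  have hx : 0 ≤ x := zero_le_one.trans (h 0 k.succ_pos)
  refine mul_le_mul_of_nonneg_right ?_ (inv_nonneg.2 hx)
  rw [← Finset.card_range k, ← Finset.prod_const, Finset.card_range]
  refine Finset.prod_le_prod (fun l hl => ?_) fun l hl => ?_ <;>
    have hl' : l + 1 < k + 1 := Nat.succ_lt_succ (Finset.mem_range.1 hl)
  · exact inv_nonneg.2 (zero_le_one.trans ((h _ hl').trans (iterLog_succ_le_log h l hl')))
  · exact inv_anti₀ (zero_lt_one.trans_le (h _ hl')) (iterLog_succ_le_log h l hl')

/-- The discretization errors, cubic in the logarithmic derivative and hence `O(x⁻³)`, are negligible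
against `1 / (ln_0 x ⋯ ln_k x)²`. -/
lemma eventually_iterLogDerivSum_pow_le (k : ℕ) {ε : ℝ} (hε : 0 < ε) :
    ∀ᶠ x : ℝ in atTop,
      iterLogDerivSum (k + 1) x ^ 3 ≤ ε * iterLogDeriv (k + 1) x ^ 2 := by
  have hc : (0 : ℝ) < ε / (k + 1) ^ 3 := by positivity
  filter_upwards [eventually_one_le_iterLog (k + 1), eventually_gt_atTop 1,
    (Real.isLittleO_pow_log_id_atTop (n := 2 * k)).bound hc] with x h hx hb
  have hlog : 0 < Real.log x := Real.log_pos hx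
  have hx0 : 0 < x := by linarith
  simp only [Real.norm_eq_abs, id, abs_of_pos hx0, abs_of_pos (pow_pos hlog _)] at hb
  have h1 := pow_le_pow_left₀ (iterLogDerivSum_nonneg h le_rfl) (iterLogDerivSum_le_div h) 3
  have h2 := pow_le_pow_left₀ (by positivity) (inv_mul_inv_log_pow_le h) 2
  refine h1.trans (le_trans ?_ (mul_le_mul_of_nonneg_left h2 hε.le))
  have h3 : (x⁻¹ * (Real.log x)⁻¹ ^ k) ^ 2 = (x ^ 2 * Real.log x ^ (2 * k))⁻¹ := by
    rw [mul_pow, inv_pow, inv_pow, inv_pow, mul_inv, ← pow_mul, mul_comm k 2]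
  have h4 : Real.log x ^ (2 * k) * (k + 1) ^ 3 ≤ ε * x := by
    rwa [div_mul_eq_mul_div, le_div_iff₀ (by positivity)] at hb
  rw [h3, ← div_eq_mul_inv ε, le_div_iff₀ (by positivity)]
  push_cast
  calc ((k + 1 : ℝ) * x⁻¹) ^ 3 * (x ^ 2 * Real.log x ^ (2 * k))
      = (Real.log x ^ (2 * k) * (k + 1) ^ 3) * x⁻¹ := by field_simp
    _ ≤ ε * x * x⁻¹ := by gcongr
    _ = ε := by field_simp

/-! ### The critical Riccati equation -/

/-- The algebraic identity behind `V' + V² = -(1/4) ∑_{j<k} (iterLogDeriv (j + 1))²` for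
`V = iterLogDerivSum k / 2`. -/
lemma two_mul_sum_iterLogDeriv_mul_sum (k : ℕ) (x : ℝ) :
    2 * ∑ j ∈ Finset.range k, iterLogDeriv (j + 1) x * iterLogDerivSum (j + 1) x =
      iterLogDerivSum k x ^ 2 + ∑ j ∈ Finset.range k, iterLogDeriv (j + 1) x ^ 2 := by
  induction k with
  | zero => simp [iterLogDerivSum]
  | succ k ih =>
    rw [Finset.sum_range_succ, mul_add, ih, iterLogDerivSum_succ, Finset.sum_range_succ]
    ring

/-- `iterLogDerivSum k / 2` satisfies, from above, the difference version of the Riccati equation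
`V' + V² = -(1/4) ∑_{j<k} (iterLogDeriv (j + 1))²`. -/
lemma le_riccati_iterLogDerivSum {k : ℕ} {x : ℝ} (h : ∀ j < k, 1 ≤ iterLog j x) :
    -(1 / 4) * ∑ j ∈ Finset.range k, iterLogDeriv (j + 1) x ^ 2 ≤
      iterLogDerivSum k (x + 1) / 2 - iterLogDerivSum k x / 2 + (iterLogDerivSum k x / 2) ^ 2 := by
  have h1 : ∑ j ∈ Finset.range k, (iterLogDeriv (j + 1) x * (1 - iterLogDerivSum (j + 1) x)) ≤
      iterLogDerivSum k (x + 1) :=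
    Finset.sum_le_sum fun j hj => le_iterLogDeriv_add_one h (Finset.mem_range.1 hj)
  have h2 := two_mul_sum_iterLogDeriv_mul_sum k x
  simp only [mul_sub, mul_one, Finset.sum_sub_distrib] at h1
  rw [← iterLogDerivSum] at h1
  linarith

/-- The companion of `le_riccati_iterLogDerivSum`: the Riccati equation holds up to a cubic
error. -/
lemma riccati_iterLogDerivSum_le {k : ℕ} {x : ℝ} (h : ∀ j < k, 1 ≤ iterLog j x)
    (hS : iterLogDerivSum k x ≤ 1) :
    iterLogDerivSum k (x + 1) / 2 - iterLogDerivSum k x / 2 + (iterLogDerivSum k x / 2) ^ 2 ≤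
      -(1 / 4) * ∑ j ∈ Finset.range k, iterLogDeriv (j + 1) x ^ 2 + iterLogDerivSum k x ^ 3 := by
  have h1 : iterLogDerivSum k (x + 1) ≤ ∑ j ∈ Finset.range k,
      (iterLogDeriv (j + 1) x - iterLogDeriv (j + 1) x * iterLogDerivSum (j + 1) x +
        iterLogDeriv (j + 1) x * (2 * iterLogDerivSum k x ^ 2)) := by
    refine Finset.sum_le_sum fun j hj => ?_
    have hj' : j + 1 ≤ k := Finset.mem_range.1 hj
    have hm := iterLogDerivSum_mono h hj' le_rfl
    have h3 := pow_le_pow_left₀ (iterLogDerivSum_nonneg h hj') hm 2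
    have h4 := mul_le_mul_of_nonneg_left h3 (iterLogDeriv_pos h hj').le
    linarith [iterLogDeriv_add_one_le h hj' (hm.trans hS)]
  have h2 := two_mul_sum_iterLogDeriv_mul_sum k x
  simp only [Finset.sum_add_distrib, Finset.sum_sub_distrib, ← Finset.sum_mul] at h1
  rw [← iterLogDerivSum] at h1
  nlinarith

lemma sum_iterLogDeriv_sq_add_one_le {k : ℕ} {x : ℝ} (h : ∀ j < k, 1 ≤ iterLog j x) :
    ∑ j ∈ Finset.range k, iterLogDeriv (j + 1) (x + 1) ^ 2 ≤
      ∑ j ∈ Finset.range k, iterLogDeriv (j + 1) x ^ 2 := by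
  have hx1 : x ≤ x + 1 := by linarith
  exact Finset.sum_le_sum fun j hj => pow_le_pow_left₀
    (iterLogDeriv_pos (one_le_iterLog_of_le h hx1) (Finset.mem_range.1 hj)).le
    (iterLogDeriv_le_of_le h hx1 (Finset.mem_range.1 hj)) 2

lemma le_sum_iterLogDeriv_sq_add_one {k : ℕ} {x : ℝ} (h : ∀ j < k, 1 ≤ iterLog j x)
    (hS : iterLogDerivSum k x ≤ 1) :
    ∑ j ∈ Finset.range k, iterLogDeriv (j + 1) x ^ 2 - 2 * iterLogDerivSum k x ^ 3 ≤
      ∑ j ∈ Finset.range k, iterLogDeriv (j + 1) (x + 1) ^ 2 := by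
  have h1 : ∑ j ∈ Finset.range k, (iterLogDeriv (j + 1) x ^ 2 * (1 - iterLogDerivSum k x) ^ 2) ≤
      ∑ j ∈ Finset.range k, iterLogDeriv (j + 1) (x + 1) ^ 2 := by
    refine Finset.sum_le_sum fun j hj => ?_
    have hj' : j + 1 ≤ k := Finset.mem_range.1 hj
    rw [← mul_pow]
    refine pow_le_pow_left₀ (mul_nonneg (iterLogDeriv_pos h hj').le (sub_nonneg.2 hS)) ?_ 2
    refine le_trans ?_ (le_iterLogDeriv_add_one h hj')
    exact mul_le_mul_of_nonneg_left (sub_le_sub_left (iterLogDerivSum_mono h hj' le_rfl) 1)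
      (iterLogDeriv_pos h hj').le
  have h2 : ∑ j ∈ Finset.range k, iterLogDeriv (j + 1) x ^ 2 ≤ iterLogDerivSum k x ^ 2 := by
    refine Finset.sum_sq_le_sq_sum_of_nonneg fun j hj => ?_
    exact (iterLogDeriv_pos h (Finset.mem_range.1 hj)).le
  rw [← Finset.sum_mul] at h1
  have h3 : 0 ≤ ∑ j ∈ Finset.range k, iterLogDeriv (j + 1) x ^ 2 :=
    Finset.sum_nonneg fun _ _ => sq_nonneg _
  have hS0 := iterLogDerivSum_nonneg h le_rfl
  nlinarith [mul_le_mul_of_nonneg_right h2 hS0, mul_nonneg h3 (sq_nonneg (iterLogDerivSum k x))]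

/-! ### Nodes and positivity of solutions -/

lemma scaledDeviation_mul_sq {k n : ℕ} (b : ℕ → ℝ)
    (h : ∀ j < k + 1, 1 ≤ iterLog j (n : ℝ)) :
    scaledDeviation k b n * iterLogDeriv (k + 1) n ^ 2 =
      b n - 2 + 1 / 4 * ∑ j ∈ Finset.range k, iterLogDeriv (j + 1) (n : ℝ) ^ 2 := by
  have h1 : ∏ j ∈ Finset.range (k + 1), iterLog j (n : ℝ) ≠ 0 :=
    Finset.prod_ne_zero_iff.2 fun j hj => by linarith [h j (Finset.mem_range.1 hj)]
  have h2 : ∀ j, 1 / ∏ l ∈ Finset.range (j + 1), iterLog l (n : ℝ) ^ 2 =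
      iterLogDeriv (j + 1) (n : ℝ) ^ 2 := fun j => by
    rw [iterLogDeriv, Finset.prod_inv_distrib, Finset.prod_pow, inv_pow, one_div]
  rw [scaledDeviation, criticalPotential, Finset.sum_congr rfl fun j _ => h2 j, iterLogDeriv,
    Finset.prod_inv_distrib]
  field_simp
  ring

lemma IsNontrivialSolution.neg {a b u : ℕ → ℝ} (hu : IsNontrivialSolution a b u) :
    IsNontrivialSolution a b (-u) := by
  refine ⟨neg_ne_zero.2 hu.1, fun n hn => ?_⟩
  have := hu.2 n hn
  simp only [jacobiExpr, Pi.neg_apply] at this ⊢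
  linarith

lemma nodes_neg (a u : ℕ → ℝ) : nodes a (-u) = nodes a u := by
  simp [nodes]

lemma IsNontrivialSolution.recurrence {b u : ℕ → ℝ}
    (hu : IsNontrivialSolution (fun _ => -1) b u) (n : ℕ) :
    u (n + 2) = b (n + 1) * u (n + 1) - u n := by
  have := hu.2 (n + 1) (Nat.le_add_left 1 n)
  simp only [jacobiExpr, Nat.add_sub_cancel] at this
  linarith

lemma IsNontrivialSolution.ne_zero_succ {b u : ℕ → ℝ}
    (hu : IsNontrivialSolution (fun _ => -1) b u) {m : ℕ} (hm : u m = 0) : u (m + 1) ≠ 0 := by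
  intro hm1
  refine hu.1 ?_
  have h0 : u 0 = 0 ∧ u 1 = 0 := by
    induction m with
    | zero => exact ⟨hm, hm1⟩
    | succ m ih =>
      refine ih ?_ hm
      have := hu.recurrence m
      rw [hm, hm1] at this
      linarith
  have h : ∀ n, u n = 0 ∧ u (n + 1) = 0 := by
    intro n
    induction n with
    | zero => exact h0
    | succ n ih => exact ⟨ih.2, by rw [hu.recurrence n, ih.1, ih.2]; ring⟩
  exact funext fun n => (h n).1

/-- Once a solution rises through zero it stays above the positive supersolution with ratios `ρ`. -/
lemma IsNontrivialSolution.pos_of_riccati_le {b u ρ : ℕ → ℝ} {N m : ℕ}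
    (hu : IsNontrivialSolution (fun _ => -1) b u) (hρ : ∀ n ≥ N, 0 < ρ n)
    (h : ∀ n ≥ N, ρ (n + 1) + 1 / ρ n ≤ b (n + 1)) (hm : N ≤ m) (hum : u m ≤ 0)
    (hum1 : 0 < u (m + 1)) : ∀ n ≥ m, ρ n * u n ≤ u (n + 1) ∧ 0 < u (n + 1) := by
  intro n hn
  induction n, hn using Nat.le_induction with
  | base => exact ⟨(mul_nonpos_of_nonneg_of_nonpos (hρ m hm).le hum).trans hum1.le, hum1⟩
  | succ n hn ih =>
    have hρn := hρ n (hm.trans hn)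
    have h1 : u n ≤ 1 / ρ n * u (n + 1) := by
      rw [one_div, ← div_eq_inv_mul, le_div_iff₀ hρn, mul_comm]
      exact ih.1
    have h2 := mul_le_mul_of_nonneg_right (h n (hm.trans hn)) ih.2.le
    have h3 : ρ (n + 1) * u (n + 1) ≤ u (n + 1 + 1) := by
      rw [hu.recurrence n]; linarith
    exact ⟨h3, (mul_pos (hρ _ ((hm.trans hn).trans n.le_succ)) ih.2).trans_le h3⟩

/-- A positive supersolution of the Riccati difference equation near infinity forces
nonoscillation: after a first node beyond `N` a solution can have no further one. -/
lemma isNonoscillatory_of_riccati_le {b ρ : ℕ → ℝ} {N : ℕ} (hρ : ∀ n ≥ N, 0 < ρ n)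
    (h : ∀ n ≥ N, ρ (n + 1) + 1 / ρ n ≤ b (n + 1)) : IsNonoscillatory (fun _ => -1) b := by
  have key : ∀ u m, IsNontrivialSolution (fun _ => -1) b u → N ≤ m → u m ≤ 0 → 0 < u (m + 1) →
      (nodes (fun _ => -1) u).Finite := by
    intro u m hu hm hum hum1
    have hpos := hu.pos_of_riccati_le hρ h hm hum hum1
    refine (Set.finite_Iic m).subset fun n hn => ?_
    by_contra hnm
    obtain ⟨j, rfl⟩ := Nat.exists_eq_add_of_lt (not_le.1 hnm)
    have h1 := (hpos (m + j) (by omega)).2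
    have h2 := (hpos (m + j + 1) (by omega)).2
    rcases hn.2 with h0 | h0
    · linarith
    · linarith [mul_pos h1 h2]
  intro u hu
  by_cases hN : ∃ m ∈ nodes (fun _ => -1) u, N ≤ m
  · obtain ⟨m, hmu, hm⟩ := hN
    have hsign : (u m ≤ 0 ∧ 0 < u (m + 1)) ∨ (0 ≤ u m ∧ u (m + 1) < 0) := by
      rcases hmu.2 with h0 | h0
      · rcases lt_or_gt_of_ne (hu.ne_zero_succ h0) with h1 | h1
        · exact Or.inr ⟨h0.ge, h1⟩
        · exact Or.inl ⟨h0.le, h1⟩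
      · have h0' : u m * u (m + 1) < 0 := by linarith
        rcases mul_neg_iff.1 h0' with h1 | h1
        · exact Or.inr ⟨h1.1.le, h1.2⟩
        · exact Or.inl ⟨h1.1.le, h1.2⟩
    rcases hsign with ⟨h0, h1⟩ | ⟨h0, h1⟩
    · exact key u m hu hm h0 h1
    · rw [← nodes_neg]
      exact key (-u) m hu.neg hm (neg_nonpos.2 h0) (neg_pos.2 h1)
  · push Not at hN
    exact (Set.finite_Iio N).subset fun n hn => hN n hn

/-- A solution with finitely many nodes has, up to sign, a positive tail. -/
lemma isOscillatory_of_not_pos {b : ℕ → ℝ}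
    (h : ∀ (u : ℕ → ℝ) (N : ℕ), (∀ n ≥ N, 0 < u n) → ¬ ∀ n, u (n + 2) = b (n + 1) * u (n + 1) - u n) :
    IsOscillatory (fun _ => -1) b := by
  intro u hu hfin
  obtain ⟨M, hM⟩ := hfin.bddAbove
  have hnode : ∀ n ≥ M + 1, 0 < u n * u (n + 1) := by
    intro n hn
    have hn' : n ∉ nodes (fun _ => -1) u := fun hmem => by have := hM hmem; omega
    have hn1 : n + 1 ∉ nodes (fun _ => -1) u := fun hmem => by have := hM hmem; omega
    simp only [nodes, Set.mem_ofPred_eq, not_and, not_or, not_lt] at hn' hn1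
    have h1 := hn' (by omega)
    have h2 := hn1 (by omega)
    exact lt_of_le_of_ne (by linarith [h1.2]) (mul_ne_zero h1.1 h2.1).symm
  rcases lt_or_ge 0 (u (M + 1)) with h0 | h0
  · refine h u (M + 1) (fun n hn => ?_) hu.recurrence
    induction n, hn using Nat.le_induction with
    | base => exact h0
    | succ n hn ih => exact (mul_pos_iff_of_pos_left ih).1 (hnode n hn)
  · refine h (-u) (M + 1) (fun n hn => ?_) hu.neg.recurrence
    rw [Pi.neg_apply, neg_pos]
    induction n, hn using Nat.le_induction with
    | base => exact lt_of_le_of_ne h0 fun h1 => by simpa [h1] using hnode (M + 1) le_rfl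
    | succ n hn ih => exact neg_of_mul_pos_right (hnode n hn) ih.le

/-! ### The nonoscillatory case -/

/-- The ratios `1 + iterLogDerivSum (k + 1) n / 2` form the required Riccati supersolution. -/
lemma isNonoscillatory_of_gt {k : ℕ} {b : ℕ → ℝ} {c : ℝ} (hc : -1 / 4 < c)
    (hb : ∀ᶠ n : ℕ in atTop, c < scaledDeviation k b n) : IsNonoscillatory (fun _ => -1) b := by
  -- The factor `4` pays for comparing `iterLogDeriv (k + 1)` at `n` and at `n + 1`.
  have hε : 0 < (c + 1 / 4) / 4 := by linarith
  have hev := ((eventually_one_le_iterLog (k + 1)).and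
    (eventually_iterLogDerivSum_pow_le k hε)).and (eventually_ge_atTop (2 * (k + 1 : ℝ)))
  obtain ⟨N, hN⟩ := eventually_atTop.1
    ((tendsto_natCast_atTop_atTop.eventually hev).and hb)
  refine isNonoscillatory_of_riccati_le (N := N)
    (ρ := fun n => 1 + iterLogDerivSum (k + 1) n / 2) (fun n hn => ?_) fun n hn => ?_
  · have := iterLogDerivSum_nonneg (hN n hn).1.1.1 le_rfl
    positivity
  · obtain ⟨⟨⟨h, hS3⟩, hnk⟩, -⟩ := hN n hn
    have hS0 := iterLogDerivSum_nonneg h le_rfl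
    have hS : iterLogDerivSum (k + 1) (n : ℝ) ≤ 1 / 2 := by
      have hn0 : (0 : ℝ) < n := lt_of_lt_of_le (by positivity) hnk
      refine (iterLogDerivSum_le_div h).trans ?_
      rw [← div_eq_mul_inv, div_le_iff₀ hn0]
      push_cast
      linarith
    obtain ⟨⟨⟨h', -⟩, -⟩, hc'⟩ := hN (n + 1) (by omega)
    have hdev := scaledDeviation_mul_sq b h'
    have hD := iterLogDeriv_pos h (le_refl (k + 1))
    have hD' := iterLogDeriv_pos h' (le_refl (k + 1))
    have h1 := mul_le_mul_of_nonneg_right hc'.le (sq_nonneg (iterLogDeriv (k + 1) ((n + 1 : ℕ) : ℝ)))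
    have h2 := riccati_iterLogDerivSum_le h (by linarith)
    have h3 := sum_iterLogDeriv_sq_add_one_le h
    have h4 := le_iterLogDeriv_add_one h (le_refl (k + 1))
    rw [Finset.sum_range_succ _ k] at h3
    push_cast at hdev h1 hD' ⊢
    have h5 : iterLogDeriv (k + 1) (n : ℝ) * (1 / 2) ≤ iterLogDeriv (k + 1) (n + 1 : ℝ) :=
      le_trans (mul_le_mul_of_nonneg_left (by linarith) hD.le) h4
    have h6 := pow_le_pow_left₀ (by positivity) h5 2
    have h7 := mul_le_mul_of_nonneg_left h6 hε.le
    have h8 : 1 / (1 + iterLogDerivSum (k + 1) (n : ℝ) / 2) ≤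
        1 - iterLogDerivSum (k + 1) (n : ℝ) / 2 + (iterLogDerivSum (k + 1) (n : ℝ) / 2) ^ 2 := by
      rw [div_le_iff₀ (by positivity)]
      nlinarith [pow_nonneg hS0 3]
    simp only [Finset.sum_range_succ _ k] at h2 h3
    linarith

/-! ### The oscillatory case -/

/-- Blow-up for the discrete form of `y' ≤ -z (y² + δ)` with `∑ z = ∞`: first the term `δ` drives
`y` to `-∞`, and then the term `y²` makes `-1/y` decrease by an infinite amount while it has to stay
positive. The bound `-1 ≤ z y` keeps the step size under control; `G` witnesses the divergence
of `∑ z`. -/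
lemma false_of_riccati_decrement {y z G : ℕ → ℝ} {δ : ℝ} {N : ℕ} (hδ : 0 < δ)
    (hz : ∀ n ≥ N, 0 < z n) (hy : ∀ n ≥ N, y (n + 1) ≤ y n - z n * (y n ^ 2 + δ))
    (hzy : ∀ n ≥ N, -1 ≤ z n * y n) (hG : ∀ n ≥ N, G (n + 1) - G n ≤ z n)
    (hGtop : Tendsto G atTop atTop) : False := by
  have h1 : ∀ n ≥ N, y n + δ * G n ≤ y N + δ * G N := by
    intro n hn
    induction n, hn using Nat.le_induction with
    | base => exact le_rfl
    | succ n hn ih =>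
      have h2 := mul_le_mul_of_nonneg_left (hG n hn) hδ.le
      have h3 := mul_nonneg (hz n hn).le (sq_nonneg (y n))
      linarith [hy n hn]
  obtain ⟨M, hM⟩ := eventually_atTop.1
    ((hGtop.eventually_gt_atTop ((y N + δ * G N) / δ)).and (eventually_ge_atTop N))
  have hneg : ∀ n ≥ M, y n < 0 := by
    intro n hn
    have h2 := h1 n (hM n hn).2
    have h3 := (div_lt_iff₀ hδ).1 (hM n hn).1
    linarith
  have h2 : ∀ n ≥ M, G n / 2 - (y n)⁻¹ ≤ G M / 2 - (y M)⁻¹ := by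
    intro n hn
    induction n, hn using Nat.le_induction with
    | base => exact le_rfl
    | succ n hn ih =>
      have hn' := (hM n hn).2
      have hx : 0 < -y n := neg_pos.2 (hneg n hn)
      have hzn := hz n hn'
      have h3 : -y n * (1 + z n * -y n) ≤ -y (n + 1) := by
        have := mul_pos hzn hδ
        linarith [hy n hn']
      have h4 : (-y (n + 1))⁻¹ ≤ (-y n * (1 + z n * -y n))⁻¹ := inv_anti₀ (by positivity) h3
      have h5 : (-y n * (1 + z n * -y n))⁻¹ ≤ (-y n)⁻¹ - z n / 2 := by
        have h6 : (-y n * (1 + z n * -y n))⁻¹ = (-y n)⁻¹ - z n / (1 + z n * -y n) := by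
          have hne : 1 + z n * -y n ≠ 0 := by positivity
          generalize -y n = x at hx hne
          field_simp
          ring
        rw [h6]
        have : z n / 2 ≤ z n / (1 + z n * -y n) :=
          div_le_div_of_nonneg_left hzn.le (by positivity) (by linarith [hzy n hn'])
        linarith
      have h7 := h4.trans h5
      rw [inv_neg, inv_neg] at h7
      linarith [hG n hn']
  obtain ⟨K, hK⟩ := eventually_atTop.1
    ((hGtop.eventually_gt_atTop (2 * (G M / 2 - (y M)⁻¹))).and (eventually_ge_atTop M))
  have h3 := h2 K (hK K le_rfl).2
  have h4 := (hK K le_rfl).1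
  have h5 := inv_lt_zero.2 (hneg K (hK K le_rfl).2)
  linarith

/-- A positive concave sequence is nondecreasing, and its logarithmic increments are at most
`1 / (n - N)`. -/
lemma sub_nonneg_and_le_of_concave_of_pos {u : ℕ → ℝ} {N : ℕ} (hu : ∀ n ≥ N, 0 < u n)
    (hc : ∀ n ≥ N, u (n + 2) - u (n + 1) ≤ u (n + 1) - u n) :
    ∀ n ≥ N, 0 ≤ u (n + 1) - u n ∧ (n - N : ℝ) * (u (n + 1) - u n) ≤ u n := by
  have hanti : ∀ m ≥ N, ∀ n ≥ m, u (n + 1) - u n ≤ u (m + 1) - u m := by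
    intro m hm n hn
    induction n, hn using Nat.le_induction with
    | base => exact le_rfl
    | succ n hn ih => exact (hc n (hm.trans hn)).trans ih
  intro n hn
  constructor
  · by_contra! hlt
    have hlin : ∀ j : ℕ, u (n + j) ≤ u n + j * (u (n + 1) - u n) := by
      intro j
      induction j with
      | zero => simp
      | succ j ih =>
        have := hanti n hn (n + j) (Nat.le_add_right n j)
        push_cast
        rw [← add_assoc]
        linarith
    obtain ⟨j, hj⟩ := exists_nat_gt (u n / -(u (n + 1) - u n))
    have h1 := (div_lt_iff₀ (neg_pos.2 hlt)).1 hj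
    linarith [hlin j, hu (n + j) (hn.trans (Nat.le_add_right n j))]
  · have : ∀ m ≥ N, m ≤ n → (m - N : ℝ) * (u (n + 1) - u n) ≤ u m := by
      intro m hm
      induction m, hm using Nat.le_induction with
      | base => intro _; simpa using (hu N le_rfl).le
      | succ m hm ih =>
        intro hmn
        have := hanti m hm n (by omega)
        push_cast
        linarith [ih (by omega)]
    exact this n hn le_rfl

/-- For a nondecreasing step, the increment `y / x - 1` of a solution satisfies the Riccati inequality
up to a cubic error, because `1 / (1 + s) ≥ 1 - s + s² - s³` for `s ≥ 0`. -/
lemma riccati_sub_le {x y w β : ℝ} (hx : 0 < x) (hxy : x ≤ y) (hw : w = β * y - x) :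
    (w / y - 1) - (y / x - 1) + (y / x - 1) ^ 2 ≤ β - 2 + (y / x - 1) ^ 3 := by
  have hy : 0 < y := hx.trans_le hxy
  obtain ⟨s, rfl⟩ : ∃ s, y = x * (1 + s) := ⟨y / x - 1, by field_simp; ring⟩
  have hs : 0 ≤ s := by
    by_contra! hs
    nlinarith
  have h1 : x * (1 + s) / x - 1 = s := by field_simp; ring
  have h2 : w / (x * (1 + s)) = β - 1 / (1 + s) := by rw [hw]; field_simp
  rw [h1, h2]
  have h3 : 1 - s + s ^ 2 - s ^ 3 ≤ 1 / (1 + s) := by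
    rw [le_div_iff₀ (by positivity)]
    nlinarith [pow_nonneg hs 4]
  linarith

/-- The substitution `s = S/2 + z y` in the Riccati inequality. The terms linear in `y` cancel to
second order because `z' ≈ z (1 - S)`, which leaves the discrete form of `y' ≤ -z (y² + δ)`. Here
primes denote values at the next index. -/
lemma quotient_decrement {s s' S S' z z' δ : ℝ} (hz : 0 < z) (hz' : 0 < z') (hzz : z' ≤ z)
    (hs0 : 0 ≤ s) (hsS : s ≤ 2 * S) (hδ : 0 < δ)
    (hlow : z * (1 - S) ≤ z') (hup : z' ≤ z * (1 - S + 2 * S ^ 2))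
    (hd : (s' - S' / 2) - (s - S / 2) + s ^ 2 - (S / 2) ^ 2 ≤ 9 * S ^ 3 - 2 * δ * z ^ 2)
    (hS3 : 13 * S ^ 3 ≤ δ * z ^ 2) :
    (s' - S' / 2) / z' ≤
      (s - S / 2) / z - z * (((s - S / 2) / z) ^ 2 + δ) := by
  obtain ⟨y, hy⟩ : ∃ y, s - S / 2 = z * y := ⟨(s - S / 2) / z, by field_simp⟩
  have hS0 : 0 ≤ S := by linarith
  have hy' : (s - S / 2) / z = y := by rw [hy]; field_simp
  rw [hy', div_le_iff₀ hz']
  have hsq : s ^ 2 - (S / 2) ^ 2 = (z * y) ^ 2 + z * y * S := by rw [← hy]; ring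
  have h1 : -(4 * S ^ 3) ≤ y * z' - y * z * (1 - S) := by
    have hyz : -(2 * S) ≤ z * y := by rw [← hy]; linarith
    rcases le_or_gt 0 y with h0 | h0
    · have := mul_le_mul_of_nonneg_left hlow h0
      nlinarith [pow_nonneg hS0 3]
    · have := mul_le_mul_of_nonpos_left hup h0.le
      nlinarith [mul_le_mul_of_nonneg_right hyz (sq_nonneg S)]
  have h2 : z * (y ^ 2 + δ) * z' ≤ z * (y ^ 2 + δ) * z :=
    mul_le_mul_of_nonneg_left hzz (by positivity)
  nlinarith

/-- A positive tail of a solution is concave, hence has logarithmic increments `O(1/n)`; subtracting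
the critical Riccati solution from them then contradicts `false_of_riccati_decrement`. -/
lemma isOscillatory_of_lt {k : ℕ} {b : ℕ → ℝ} {c : ℝ} (hc : c < -1 / 4)
    (hb : ∀ᶠ n : ℕ in atTop, scaledDeviation k b n < c) : IsOscillatory (fun _ => -1) b := by
  refine isOscillatory_of_not_pos fun u N₀ hpos hrec => ?_
  -- One eighth of the gap: a factor `4` is lost in passing from `z (n + 1) ^ 2` to `z n ^ 2`,
  -- and half of the rest absorbs the cubic errors.
  set δ : ℝ := (-1 / 4 - c) / 8 with hδdef
  have hδ : 0 < δ := by rw [hδdef]; linarith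
  have hev := ((eventually_one_le_iterLog (k + 1)).and
    (eventually_iterLogDerivSum_pow_le k (by positivity : 0 < δ / 13))).and
    (eventually_ge_atTop (2 * (k + 1 : ℝ)))
  obtain ⟨N₁, hN₁⟩ := eventually_atTop.1 ((tendsto_natCast_atTop_atTop.eventually hev).and hb)
  have hq : ∀ n ≥ N₁, b n - 2 ≤ -(1 / 4) * ∑ j ∈ Finset.range (k + 1),
      iterLogDeriv (j + 1) (n : ℝ) ^ 2 - 8 * δ * iterLogDeriv (k + 1) n ^ 2 := by
    intro n hn
    obtain ⟨⟨⟨h, -⟩, -⟩, hcn⟩ := hN₁ n hn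
    have h1 := scaledDeviation_mul_sq b h
    have h2 := mul_le_mul_of_nonneg_right hcn.le (sq_nonneg (iterLogDeriv (k + 1) (n : ℝ)))
    rw [Finset.sum_range_succ, hδdef]
    linarith
  set N₂ := max N₀ N₁
  have hconc : ∀ n ≥ N₂, u (n + 2) - u (n + 1) ≤ u (n + 1) - u n := by
    intro n hn
    have h1 := hq (n + 1) (by omega)
    have h2 : 0 ≤ ∑ j ∈ Finset.range (k + 1), iterLogDeriv (j + 1) ((n + 1 : ℕ) : ℝ) ^ 2 :=
      Finset.sum_nonneg fun _ _ => sq_nonneg _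
    have h3 : 0 ≤ 8 * δ * iterLogDeriv (k + 1) ((n + 1 : ℕ) : ℝ) ^ 2 := by positivity
    have h4 : b (n + 1) - 2 ≤ 0 := by linarith
    have h5 := mul_nonpos_of_nonpos_of_nonneg h4 (hpos (n + 1) (by omega)).le
    rw [hrec n]
    linarith
  have hΔ := sub_nonneg_and_le_of_concave_of_pos
    (fun n hn => hpos n (by omega : n ≥ N₀)) hconc
  set z : ℕ → ℝ := fun n => iterLogDeriv (k + 1) n with hz
  set S : ℕ → ℝ := fun n => iterLogDerivSum (k + 1) n with hS
  set s : ℕ → ℝ := fun n => u (n + 1) / u n - 1 with hs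
  have hfacts : ∀ n ≥ 2 * N₂, 0 < z n ∧ 0 ≤ s n ∧ s n ≤ 2 * S n ∧ S n ≤ 1 / 2 := by
    intro n hn
    obtain ⟨⟨⟨h, -⟩, hnk⟩, -⟩ := hN₁ n (by omega)
    have hn0 : (0 : ℝ) < n := lt_of_lt_of_le (by positivity) hnk
    have hun := hpos n (by omega)
    obtain ⟨h1, h2⟩ := hΔ n (by omega)
    refine ⟨iterLogDeriv_pos h le_rfl, ?_, ?_, ?_⟩
    · rw [hs, sub_nonneg, one_le_div hun]
      linarith
    · refine le_trans ?_ (mul_le_mul_of_nonneg_left (inv_le_iterLogDerivSum h) zero_le_two)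
      have hcast : 2 * (N₂ : ℝ) ≤ n := by exact_mod_cast hn
      have h3 : (n : ℝ) / 2 * (u (n + 1) - u n) ≤ u n :=
        le_trans (mul_le_mul_of_nonneg_right (by linarith) h1) h2
      have h4 : s n = (u (n + 1) - u n) / u n := by
        rw [hs]; field_simp
      rw [h4, div_le_iff₀ hun, ← div_eq_mul_inv, div_mul_eq_mul_div, le_div_iff₀ hn0]
      linarith
    · refine (iterLogDerivSum_le_div h).trans ?_
      rw [← div_eq_mul_inv, div_le_iff₀ hn0]
      push_cast
      linarith
  refine false_of_riccati_decrement (y := fun n => (s n - S n / 2) / z n) (z := z)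
    (G := fun n => iterLog (k + 1) n) (N := 2 * N₂) hδ (fun n hn => (hfacts n hn).1)
    (fun n hn => ?_) (fun n hn => ?_) (fun n hn => ?_)
    ((tendsto_iterLog_atTop _).comp tendsto_natCast_atTop_atTop)
  · obtain ⟨⟨⟨h, hS3⟩, -⟩, -⟩ := hN₁ n (by omega)
    obtain ⟨hzn, hs0, hsS, hSn⟩ := hfacts n hn
    have hzn' := (hfacts (n + 1) (by omega)).1
    have hup := iterLogDeriv_add_one_le h (le_refl (k + 1)) (by linarith : S n ≤ 1)
    have hlow := le_iterLogDeriv_add_one h (le_refl (k + 1))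
    have hanti := iterLogDeriv_le_of_le h (by linarith : (n : ℝ) ≤ n + 1) (le_refl (k + 1))
    have hv := le_riccati_iterLogDerivSum h
    have hsq := le_sum_iterLogDeriv_sq_add_one h (by linarith : S n ≤ 1)
    have hric := riccati_sub_le (hpos n (by omega)) (by linarith [(hΔ n (by omega)).1]) (hrec n)
    have hqn := hq (n + 1) (by omega)
    have hs3 := pow_le_pow_left₀ hs0 hsS 3
    have hzhalf : z n / 2 ≤ z (n + 1) := by
      have h1 : z n * (1 / 2) ≤ z n * (1 - S n) :=
        mul_le_mul_of_nonneg_left (by linarith) hzn.le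
      have h2 : z n * (1 - S n) ≤ z (n + 1) := by
        simp only [hz, Nat.cast_add, Nat.cast_one]; exact hlow
      linarith
    have hzsq := mul_le_mul_of_nonneg_left (pow_le_pow_left₀ (by positivity) hzhalf 2) hδ.le
    have hS0 := pow_nonneg (by linarith : 0 ≤ S n) 3
    simp only [hz, hS, hs, Nat.cast_add, Nat.cast_one] at *
    refine quotient_decrement hzn hzn' hanti hs0 hsS hδ hlow hup ?_ (by linarith)
    rw [show n + 1 + 1 = n + 2 from rfl]
    linarith
  · obtain ⟨hzn, hs0, hsS, hSn⟩ := hfacts n hn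
    rw [mul_div_cancel₀ _ hzn.ne']
    linarith
  · have h := (hN₁ n (by omega)).1.1.1
    push_cast
    exact iterLog_add_one_sub_le h

/-! ### The criterion -/

/-- The lower and upper limits are taken in the extended reals, so that they may be infinite. -/
theorem corollary2p2 (k : ℕ) (b : ℕ → ℝ) :
    (liminf (fun n : ℕ => (scaledDeviation k b n : EReal)) atTop > ((-1 / 4 : ℝ) : EReal) →
      IsNonoscillatory (fun _ => -1) b) ∧
    (limsup (fun n : ℕ => (scaledDeviation k b n : EReal)) atTop < ((-1 / 4 : ℝ) : EReal) →
      IsOscillatory (fun _ => -1) b) := by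
  constructor
  · intro h
    obtain ⟨c, hc, hc'⟩ := EReal.lt_iff_exists_real_btwn.1 h
    exact isNonoscillatory_of_gt (EReal.coe_lt_coe_iff.1 hc)
      ((eventually_lt_of_lt_liminf hc').mono fun n hn => EReal.coe_lt_coe_iff.1 hn)
  · intro h
    obtain ⟨c, hc, hc'⟩ := EReal.lt_iff_exists_real_btwn.1 h
    exact isOscillatory_of_lt (EReal.coe_lt_coe_iff.1 hc')
      ((eventually_lt_of_limsup_lt hc).mono fun n hn => EReal.coe_lt_coe_iff.1 hn)
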